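/- Let $N\ge 1$. Let the type space $\mathcal X$ and the allocation space $\mathcal Q$ be convex compact subsets of $\mathbb R_+^N$ with nonempty interior, with $0\in\mathcal Q$. Let $f\ge 0$ be a probability density on $\mathcal X$ that is continuously differentiable on the interior of $\mathcal X$ and for which $\phi(x)=x\cdot\nabla f(x)+(N+1)f(x)$ is essentially bounded. Assume that $f$ is strictly regular: $\phi(x)>0$ for almost every $x\in\mathcal X$. A mechanism is a price schedule $p:\mathcal Q\to\mathbb R$, bounded below, with $p(0)=0$. Its indirect utility is $u_p(x)=\sup_{q\in\mathcal Q}\{x\cdot q-p(q)\}$ and its revenue is $\int_{\mathcal X}[x\cdot\nabla u_p(x)-u_p(x)]f(x)\,dx$. It is optimal if no mechanism has larger revenue. Let $\bar p$ be the (closed) lower convex envelope of $p$ on $\mathcal Q$, that is, the supremum of the affine functions lying below $p$ on $\mathcal Q$. The demand set of $q\in\mathcal Q$ is $\mathcal D(q)=\{x\in\mathcal X: x\cdot q-\bar p(q)\ge x\cdot\hat q-\bar p(\hat q)\ \text{for all } \hat q\in\mathcal Q\}$. A nonzero bundle $q\in\mathcal Q$ is active if for every $\delta>0$ the set $\bigcup\{\mathcal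 D(\hat q):\hat q\in\mathcal Q,\ \|\hat q-q\|<\delta\}$ has positive measure with respect to $f$. The top boundary of $\mathcal X$ is the set of boundary points $x$ such that $x\cdot n>0$ for every outward unit normal $n$ to $\mathcal X$ at $x$. Let $\mathcal Q_A$ be the set of boundary points $q$ of $\mathcal Q$ for which there is an outward unit normal $n$ to $\mathcal X$ at some point of the top boundary such that $q+\varepsilon n\notin\mathcal Q$ for every $\varepsilon>0$. Then for any optimal mechanism, a bundle $q$ can be active only if $q$ lies in the closure of $\mathcal Q_A$. (In particular $q\in\mathcal Q_A$ whenever $\mathcal Q_A$ is closed.) -/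

import Mathlib

open MeasureTheory Topology Set
open scoped RealInnerProductSpace

noncomputable section

/-- `ℝ^N` with the Euclidean norm: the space of types and of bundles (allocations). -/
abbrev Bundle (N : ℕ) : Type := EuclideanSpace ℝ (Fin N)

namespace Screening

variable {N : ℕ}

/-- The indirect utility `u_p(x) = sup_{q ∈ Q} (x·q - p(q))`.  For `Q` compact and nonempty and `p`
bounded below on `Q` (part of `Feasible`) the supremum is finite at every `x ∈ ℝ^N`. -/
def indirectUtility (Q : Set (Bundle N)) (p : Bundle N → ℝ) (x : Bundle N) : ℝ :=
  sSup ((fun q => ⟪x, q⟫ - p q) '' Q)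

/-- Feasible price schedules: the zero bundle is free, and `p` is bounded below on `Q`, which (for
compact `Q`) says exactly that the indirect utility is finite.  Only the values of `p` on `Q`
matter. -/
def Feasible (Q : Set (Bundle N)) (p : Bundle N → ℝ) : Prop :=
  p 0 = 0 ∧ BddBelow (p '' Q)

/-- Total revenue `TR(p) = ∫_X (x·∇u_p(x) - u_p(x)) f(x) dx`. -/
def totalRevenue (X Q : Set (Bundle N)) (f p : Bundle N → ℝ) : ℝ :=
  ∫ x in X, (⟪x, gradient (indirectUtility Q p) x⟫ - indirectUtility Q p x) * f x

/-- A mechanism is optimal if it is feasible and maximizes total revenue among all feasible ones. -/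
def IsOptimal (X Q : Set (Bundle N)) (f p : Bundle N → ℝ) : Prop :=
  Feasible Q p ∧ ∀ p', Feasible Q p' → totalRevenue X Q f p' ≤ totalRevenue X Q f p

/-- The (closed) lower convex envelope of `p` on `Q`: the supremum of the affine functions
`q ↦ y·q + c` that lie below `p` on `Q`, i.e. the convex biconjugate of `p`. -/
def lowerEnvelope (Q : Set (Bundle N)) (p : Bundle N → ℝ) (q : Bundle N) : ℝ :=
  sSup {t | ∃ (y : Bundle N) (c : ℝ), (∀ q' ∈ Q, ⟪y, q'⟫ + c ≤ p q') ∧ t = ⟪y, q⟫ + c}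

/-- The demand set of the bundle `q ∈ Q`: the types for which `q` is a best choice at the
prices given by the lower convex envelope of `p`. -/
def demandSet (X Q : Set (Bundle N)) (p : Bundle N → ℝ) (q : Bundle N) : Set (Bundle N) :=
  {x ∈ X | ∀ q' ∈ Q, ⟪x, q'⟫ - lowerEnvelope Q p q' ≤ ⟪x, q⟫ - lowerEnvelope Q p q}

/-- The demand set of a set of bundles `A` (intersected with the allocation space). -/
def demandOf (X Q : Set (Bundle N)) (p : Bundle N → ℝ) (A : Set (Bundle N)) : Set (Bundle N) :=
  ⋃ q ∈ A ∩ Q, demandSet X Q p q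

/-- The distribution of types: density `f` with respect to Lebesgue measure on `X`. -/
def typeMeasure (X : Set (Bundle N)) (f : Bundle N → ℝ) : Measure (Bundle N) :=
  (volume.restrict X).withDensity (fun x => ENNReal.ofReal (f x))

/-- A nonzero bundle `q ∈ Q` is active if for every `δ > 0` the demand set of the open
`δ`-ball around `q` has positive measure with respect to `f`. -/
def IsActive (X Q : Set (Bundle N)) (f p : Bundle N → ℝ) (q : Bundle N) : Prop :=
  q ∈ Q ∧ q ≠ 0 ∧ ∀ δ > 0, 0 < typeMeasure X f (demandOf X Q p (Metric.ball q δ))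

/-- `φ(x) = x·∇f(x) + (N+1) f(x)`. -/
def phi (f : Bundle N → ℝ) (x : Bundle N) : ℝ :=
  ⟪x, gradient f x⟫ + ((N : ℝ) + 1) * f x

/-- `f` is strictly regular on `X` if `φ > 0` almost everywhere on `X`. -/
def StrictlyRegular (X : Set (Bundle N)) (f : Bundle N → ℝ) : Prop :=
  ∀ᵐ x ∂(volume.restrict X), 0 < phi f x

/-- The outward unit normal vectors to the convex set `X` at `x`. -/
def unitNormals (X : Set (Bundle N)) (x : Bundle N) : Set (Bundle N) :=
  {n | ‖n‖ = 1 ∧ ∀ y ∈ X, ⟪n, y - x⟫ ≤ 0}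

/-- The top boundary of `X`: boundary points `x` with `x·n > 0` for all outward unit normals `n`
at `x`. -/
def topBoundary (X : Set (Bundle N)) : Set (Bundle N) :=
  {x ∈ frontier X | ∀ n ∈ unitNormals X x, 0 < ⟪x, n⟫}

/-- All outward unit normals to `X` at points of the top boundary. -/
def topNormals (X : Set (Bundle N)) : Set (Bundle N) :=
  ⋃ x ∈ topBoundary X, unitNormals X x

/-- The set `Q_A`: boundary allocations `q` such that, for some outward unit normal `n` at a point
of the top boundary of `X`, `q + ε n ∉ Q` for every `ε > 0`. -/
def candidateBundles (X Q : Set (Bundle N)) : Set (Bundle N) :=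
  {q ∈ frontier Q | ∃ n ∈ topNormals X, ∀ ε : ℝ, 0 < ε → q + ε • n ∉ Q}

end Screening

end

/-! Let `u` be the indirect utility of the optimal mechanism, `S = {0} ∪ closure Q_A`, and `v` the
biconjugate of `u` with slopes restricted to `S`, so that `v ≤ u` on `X`. A subgradient of `u` at a
top boundary point stays a subgradient relative to `X` when pushed along an outward normal, and the
push can be continued until it lands in `Q_A`. Hence `w = u - v` vanishes on the top boundary
(`le_biconjugate_of_mem_topBoundary`).

Radial integration by parts (`integral_radial_le_zero`) then bounds the revenue difference `∫ (x·∇w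
- w) f` above by `-∫ w φ`. Up to a constant that can only raise revenue, `v` comes from a feasible
schedule, so optimality gives `∫ w φ ≤ 0`. As `φ > 0` a.e. and `w ≥ 0`, `u = v` on the interior
(`indirectUtility_eqOn_biconjugate_of_isOptimal`).

So wherever `u` is differentiable inside `X`, its gradient, the only bundle that type can demand,
lies in `S`. A nonzero bundle outside the closed set `S` therefore has a neighbourhood demanded only
by a null set of types. -/

namespace Screening

variable {N : ℕ}

/-! ### Conjugates: `indirectUtility` serves as the Legendre transform in both directions. -/

section IndirectUtility

variable {S : Set (Bundle N)} {p : Bundle N → ℝ}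

theorem bddAbove_inner_sub (hS : Bornology.IsBounded S) (hp : BddBelow (p '' S)) (x : Bundle N) :
    BddAbove ((fun q => ⟪x, q⟫ - p q) '' S) := by
  obtain ⟨R, hR⟩ := hS.exists_norm_le
  obtain ⟨b, hb⟩ := hp
  refine ⟨‖x‖ * R - b, ?_⟩
  rintro _ ⟨q, hq, rfl⟩
  have h1 := real_inner_le_norm x q
  have h2 := mul_le_mul_of_nonneg_left (hR q hq) (norm_nonneg x)
  have h3 := hb ⟨q, hq, rfl⟩
  dsimp only
  linarith

theorem inner_sub_le_indirectUtility (hS : Bornology.IsBounded S) (hp : BddBelow (p '' S))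
    {q : Bundle N} (hq : q ∈ S) (x : Bundle N) : ⟪x, q⟫ - p q ≤ indirectUtility S p x :=
  le_csSup (bddAbove_inner_sub hS hp x) ⟨q, hq, rfl⟩

theorem indirectUtility_le (hne : S.Nonempty) {x : Bundle N} {b : ℝ}
    (h : ∀ q ∈ S, ⟪x, q⟫ - p q ≤ b) : indirectUtility S p x ≤ b :=
  csSup_le (hne.image _) (by rintro _ ⟨q, hq, rfl⟩; exact h q hq)

theorem exists_lipschitzWith_indirectUtility (hne : S.Nonempty) (hS : Bornology.IsBounded S)
    (hp : BddBelow (p '' S)) : ∃ L, LipschitzWith L (indirectUtility S p) := by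
  obtain ⟨R, hR⟩ := hS.exists_norm_le
  have hR0 : 0 ≤ R := (norm_nonneg _).trans (hR _ hne.some_mem)
  refine ⟨⟨R, hR0⟩, LipschitzWith.of_le_add_mul _ fun x y => ?_⟩
  refine indirectUtility_le hne fun q hq => ?_
  have h1 := inner_sub_le_indirectUtility hS hp hq y
  have h2 := real_inner_le_norm (x - y) q
  have h3 := mul_le_mul_of_nonneg_left (hR q hq) (norm_nonneg (x - y))
  rw [inner_sub_left] at h2
  rw [dist_eq_norm]
  change _ ≤ _ + R * ‖x - y‖
  linarith

/-- The supremum of affine functions with slopes in a compact set has a subgradient in that set. -/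
theorem exists_subgradient_indirectUtility (hne : S.Nonempty) (hS : IsCompact S)
    (hp : BddBelow (p '' S)) (x : Bundle N) :
    ∃ a ∈ S, ∀ y, indirectUtility S p x + ⟪a, y - x⟫ ≤ indirectUtility S p y := by
  -- `p` need not be lower semicontinuous, so the supremum may not be attained; a limit of
  -- near-maximizers still gives the inequality.
  obtain ⟨s, -, hs, hmem⟩ := exists_seq_tendsto_sSup (hne.image (fun q => ⟪x, q⟫ - p q))
    (bddAbove_inner_sub hS.isBounded hp x)
  choose a ha hsa using hmem
  obtain ⟨b, hb, φ, hφ, hlim⟩ := hS.tendsto_subseq ha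
  refine ⟨b, hb, fun y => ?_⟩
  have h1 : Filter.Tendsto (fun n => s (φ n) + ⟪a (φ n), y - x⟫) Filter.atTop
      (𝓝 (indirectUtility S p x + ⟪b, y - x⟫)) :=
    (hs.comp hφ.tendsto_atTop).add (hlim.inner tendsto_const_nhds)
  refine le_of_tendsto h1 (Filter.Eventually.of_forall fun n => ?_)
  have h2 := inner_sub_le_indirectUtility hS.isBounded hp (ha (φ n)) y
  have h3 := hsa (φ n)
  dsimp only at h3
  rw [← h3, inner_sub_right, real_inner_comm y, real_inner_comm x]
  linarith

theorem bddBelow_indirectUtility_image (hne : S.Nonempty) (hS : Bornology.IsBounded S)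
    (hp : BddBelow (p '' S)) {A : Set (Bundle N)} (hA : Bornology.IsBounded A) :
    BddBelow (indirectUtility S p '' A) := by
  obtain ⟨R, hR⟩ := hA.exists_norm_le
  obtain ⟨q, hq⟩ := hne
  refine ⟨-(R * ‖q‖) - p q, ?_⟩
  rintro _ ⟨x, hx, rfl⟩
  have h1 := inner_sub_le_indirectUtility hS hp hq x
  have h2 := neg_le_of_abs_le (abs_real_inner_le_norm x q)
  have h3 := mul_le_mul_of_nonneg_right (hR x hx) (norm_nonneg q)
  linarith

/-- The biconjugate of a function lies below it. -/
theorem indirectUtility_indirectUtility_le {X : Set (Bundle N)} {u : Bundle N → ℝ}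
    (hX : Bornology.IsBounded X) (hu : BddBelow (u '' X)) (hne : S.Nonempty)
    {x : Bundle N} (hx : x ∈ X) :
    indirectUtility S (indirectUtility X u) x ≤ u x := by
  refine indirectUtility_le hne fun q _ => ?_
  have := inner_sub_le_indirectUtility hX hu hx q
  rw [real_inner_comm] at this
  linarith

end IndirectUtility

/-! ### Subgradients, gradients and demand. -/

theorem gradient_eq_of_eventually_le {v : Bundle N → ℝ} {x a : Bundle N}
    (hv : DifferentiableAt ℝ v x) (h : ∀ᶠ y in 𝓝 x, v x + ⟪a, y - x⟫ ≤ v y) :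
    gradient v x = a := by
  have h1 : IsLocalMin (fun y => v y - ⟪a, y⟫) x := by
    filter_upwards [h] with y hy
    rw [inner_sub_right] at hy
    linarith
  have h2 : HasFDerivAt (fun y => v y - ⟪a, y⟫)
      (InnerProductSpace.toDual ℝ _ (gradient v x) - InnerProductSpace.toDual ℝ _ a) x :=
    hv.hasGradientAt.hasFDerivAt.sub (InnerProductSpace.toDual ℝ (Bundle N) a).hasFDerivAt
  have h3 := h1.hasFDerivAt_eq_zero h2
  exact (InnerProductSpace.toDual ℝ (Bundle N)).injective (sub_eq_zero.mp h3)

/-- A type demanding `q` at the envelope prices has `q` as a subgradient of the indirect utility. -/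
theorem subgradient_of_mem_demandSet {X Q : Set (Bundle N)} {p : Bundle N → ℝ}
    (hne : Q.Nonempty) (hQ : Bornology.IsBounded Q) (hp : BddBelow (p '' Q))
    {x q : Bundle N} (hq : q ∈ Q) (hx : x ∈ demandSet X Q p q) (y : Bundle N) :
    indirectUtility Q p x + ⟪q, y - x⟫ ≤ indirectUtility Q p y := by
  have hbdd : ∀ a ∈ Q, BddAbove {t | ∃ (y : Bundle N) (c : ℝ),
      (∀ q' ∈ Q, ⟪y, q'⟫ + c ≤ p q') ∧ t = ⟪y, a⟫ + c} := by
    rintro a ha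
    refine ⟨p a, ?_⟩
    rintro _ ⟨z, c, h, rfl⟩
    exact h a ha
  -- Each `z` contributes an affine minorant of `p`, which bounds the envelope from below.
  have haff : ∀ z : Bundle N, ∀ q' ∈ Q, ⟪z, q'⟫ + -indirectUtility Q p z ≤ p q' := by
    intro z q' hq'
    have := inner_sub_le_indirectUtility hQ hp hq' z
    linarith
  have henv : ∀ a ∈ Q, lowerEnvelope Q p a ≤ p a := by
    intro a ha
    refine csSup_le ⟨_, x, _, haff x, rfl⟩ ?_
    rintro _ ⟨z, c, h, rfl⟩
    exact h a ha
  have h1 : ⟪y, q⟫ + -indirectUtility Q p y ≤ lowerEnvelope Q p q :=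
    le_csSup (hbdd q hq) ⟨y, _, haff y, rfl⟩
  have h2 : indirectUtility Q p x ≤ ⟪x, q⟫ - lowerEnvelope Q p q := by
    refine indirectUtility_le hne fun a ha => ?_
    have h3 := hx.2 a ha
    have h4 := henv a ha
    linarith
  rw [inner_sub_right, real_inner_comm y, real_inner_comm x]
  linarith

/-! ### Normals, the top boundary and `Q_A`. -/

section Geometry

variable {X Q : Set (Bundle N)}

theorem exists_unitNormal (hX : Convex ℝ X) (hint : (interior X).Nonempty) {t : Bundle N}
    (ht : t ∉ interior X) : ∃ n, n ∈ unitNormals X t := by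
  obtain ⟨f, hf⟩ := geometric_hahn_banach_open_point hX.interior isOpen_interior ht
  set m := (InnerProductSpace.toDual ℝ (Bundle N)).symm f with hm
  have hfm : ∀ y, f y = ⟪m, y⟫ := fun y => by rw [hm, InnerProductSpace.toDual_symm_apply]
  have hle : ∀ y ∈ X, ⟪m, y - t⟫ ≤ 0 := by
    intro y hy
    have hy' : y ∈ closure (interior X) := by
      rw [hX.closure_interior_eq_closure_of_nonempty_interior hint]
      exact subset_closure hy
    have hcl : IsClosed {z : Bundle N | ⟪m, z - t⟫ ≤ 0} :=
      isClosed_le (by fun_prop) continuous_const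
    refine closure_minimal (fun z hz => ?_) hcl hy'
    have := hf z hz
    rw [hfm, hfm] at this
    rw [mem_ofPred_eq, inner_sub_right]
    linarith
  have hm0 : m ≠ 0 := by
    intro h0
    obtain ⟨z, hz⟩ := hint
    have := hf z hz
    rw [hfm, hfm, h0] at this
    simp at this
  refine ⟨‖m‖⁻¹ • m, ?_, fun y hy => ?_⟩
  · rw [norm_smul, norm_inv, norm_norm, inv_mul_cancel₀ (norm_ne_zero_iff.mpr hm0)]
  · rw [real_inner_smul_left]
    exact mul_nonpos_of_nonneg_of_nonpos (by positivity) (hle y hy)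

/-- A ray through an interior point leaves `X` through the top boundary. -/
theorem exists_topBoundary_on_ray (hX : IsCompact X) {x : Bundle N} (hx : x ∈ interior X)
    {s : ℝ} (hs : 0 ≤ s) (hsx : (1 + s) • x ∉ interior X) :
    ∃ r ∈ Icc 0 s, (1 + r) • x ∈ topBoundary X := by
  have hcont : Continuous fun r : ℝ => (1 + r) • x := by fun_prop
  have hK : IsCompact (Icc 0 s ∩ (fun r : ℝ => (1 + r) • x) ⁻¹' X) :=
    isCompact_Icc.inter_right (hX.isClosed.preimage hcont)
  obtain ⟨r, ⟨hr, hrX⟩, hmax⟩ := hK.exists_isMaxOn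
    ⟨0, ⟨le_rfl, hs⟩, by simpa using interior_subset hx⟩ continuousOn_id
  refine ⟨r, hr, ⟨subset_closure hrX, fun hri => ?_⟩, fun n hn => ?_⟩
  · have hlt : r < s := lt_of_le_of_ne hr.2 (by rintro rfl; exact hsx hri)
    have hev : ∀ᶠ r' in 𝓝[>] r, (1 + r') • x ∈ interior X :=
      nhdsWithin_le_nhds (hcont.continuousAt.preimage_mem_nhds (isOpen_interior.mem_nhds hri))
    obtain ⟨r', hr', hrr'⟩ := (hev.and (Ioo_mem_nhdsGT hlt)).exists
    have := hmax (⟨⟨hr.1.trans hrr'.1.le, hrr'.2.le⟩, mem_preimage.mpr (interior_subset hr')⟩ :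
      r' ∈ Icc 0 s ∩ (fun r : ℝ => (1 + r) • x) ⁻¹' X)
    simp only [id, mem_ofPred_eq] at this
    linarith [hrr'.1]
  -- Testing the normal at the exit point against `x + ε n ∈ X` gives `ε ≤ r ⟪n, x⟫`, which forces
  -- `⟪n, x⟫ > 0`.
  · obtain ⟨ε, hε, hball⟩ := Metric.nhds_basis_closedBall.mem_iff.mp
      (mem_interior_iff_mem_nhds.mp hx)
    have hmem : x + ε • n ∈ X := hball (by simp [norm_smul, hn.1, abs_of_pos hε])
    have h1 := hn.2 _ hmem
    have h2 : ⟪n, n⟫ = 1 := by rw [real_inner_self_eq_norm_sq, hn.1]; norm_num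
    rw [inner_sub_right, inner_add_right, real_inner_smul_right, real_inner_smul_right, h2] at h1
    rw [real_inner_smul_left, real_inner_comm]
    have h3 : ε ≤ r * ⟪n, x⟫ := by linarith
    have h4 : 0 < ⟪n, x⟫ := by
      by_contra! hneg
      linarith [mul_nonpos_of_nonneg_of_nonpos hr.1 hneg]
    have := hr.1
    positivity

/-- Moving a bundle of `Q` along a top normal as far as possible ends in `Q_A`. -/
theorem exists_candidate_along_normal (hQ : IsCompact Q) {q n : Bundle N} (hq : q ∈ Q)
    (hn : n ∈ topNormals X) (hn1 : ‖n‖ = 1) :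
    ∃ ε : ℝ, 0 ≤ ε ∧ q + ε • n ∈ candidateBundles X Q := by
  obtain ⟨R, hR⟩ := hQ.isBounded.exists_norm_le
  have hcont : Continuous fun ε : ℝ => q + ε • n := by fun_prop
  have hbound : ∀ ε : ℝ, 0 ≤ ε → q + ε • n ∈ Q → ε ≤ R + ‖q‖ := by
    intro ε hε hmem
    have h1 := hR _ hmem
    have h2 : ‖ε • n‖ ≤ ‖q + ε • n‖ + ‖q‖ := by
      simpa using norm_sub_le (q + ε • n) q
    rw [norm_smul, hn1, Real.norm_of_nonneg hε] at h2
    linarith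
  have hK : IsCompact (Icc 0 (R + ‖q‖) ∩ (fun ε : ℝ => q + ε • n) ⁻¹' Q) :=
    isCompact_Icc.inter_right (hQ.isClosed.preimage hcont)
  obtain ⟨ε, ⟨hε, hεQ⟩, hmax⟩ := hK.exists_isMaxOn
    ⟨0, ⟨le_rfl, hbound 0 le_rfl (by simpa using hq)⟩, by simpa using hq⟩ continuousOn_id
  have hout : ∀ η : ℝ, 0 < η → q + ε • n + η • n ∉ Q := by
    intro η hη hmem
    rw [add_assoc, ← add_smul] at hmem
    have h0 : 0 ≤ ε + η := by linarith [hε.1]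
    have := hmax (⟨⟨h0, hbound _ h0 hmem⟩, hmem⟩ :
      ε + η ∈ Icc 0 (R + ‖q‖) ∩ (fun ε : ℝ => q + ε • n) ⁻¹' Q)
    simp only [id, mem_ofPred_eq] at this
    linarith
  refine ⟨ε, hε.1, ⟨subset_closure hεQ, fun hi => ?_⟩, n, hn, hout⟩
  have hc2 : Continuous fun η : ℝ => q + ε • n + η • n := by fun_prop
  have hev : ∀ᶠ η in 𝓝[>] (0 : ℝ), q + ε • n + η • n ∈ interior Q :=
    nhdsWithin_le_nhds (hc2.continuousAt.preimage_mem_nhds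
      (isOpen_interior.mem_nhds (by simpa using hi)))
  obtain ⟨η, hη, hη0⟩ := (hev.and self_mem_nhdsWithin).exists
  exact hout η hη0 (interior_subset hη)

/-- On the top boundary, restricting the slopes to `Q_A` does not lower a convex function with
subgradients in `Q`. -/
theorem le_biconjugate_of_mem_topBoundary (hXconv : Convex ℝ X) (hint : (interior X).Nonempty)
    (hX : IsCompact X) (hQ : IsCompact Q) {u : Bundle N → ℝ} (hu : BddBelow (u '' X))
    {S : Set (Bundle N)} (hS : Bornology.IsBounded S) (hQS : candidateBundles X Q ⊆ S)
    {t a : Bundle N} (ht : t ∈ topBoundary X) (ha : a ∈ Q)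
    (hsub : ∀ y, u t + ⟪a, y - t⟫ ≤ u y) :
    u t ≤ indirectUtility S (indirectUtility X u) t := by
  have htX : t ∈ X := hX.isClosed.frontier_subset ht.1
  obtain ⟨n, hn⟩ := exists_unitNormal hXconv hint ht.1.2
  obtain ⟨ε, hε, hcand⟩ := exists_candidate_along_normal (X := X) hQ ha
    (mem_biUnion ht hn) hn.1
  have h1 := inner_sub_le_indirectUtility hS
    (bddBelow_indirectUtility_image ⟨t, htX⟩ hX.isBounded hu hS) (hQS hcand) t
  -- On `X` the added term `ε ⟪n, y - t⟫` is nonpositive, so `a + ε n` is still a subgradient at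
  -- `t`.
  have h2 : indirectUtility X u (a + ε • n) ≤ ⟪a + ε • n, t⟫ - u t := by
    refine indirectUtility_le ⟨t, htX⟩ fun y hy => ?_
    have h3 := hsub y
    have h4 := mul_nonpos_of_nonneg_of_nonpos hε (hn.2 y hy)
    rw [inner_sub_right] at h3 h4
    rw [inner_add_left, inner_add_left, real_inner_smul_left, real_inner_smul_left]
    linarith
  rw [real_inner_comm] at h1
  linarith

end Geometry

/-! ### Radial derivatives and integration by parts. -/

theorem measurable_gradient (v : Bundle N → ℝ) : Measurable (gradient v) :=
  (InnerProductSpace.toDual ℝ (Bundle N)).symm.continuous.measurable.comp (measurable_fderiv ℝ v)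

theorem norm_gradient_le_of_lipschitzWith {v : Bundle N → ℝ} {L : NNReal}
    (hv : LipschitzWith L v) (x : Bundle N) : ‖gradient v x‖ ≤ L := by
  rw [gradient, LinearIsometryEquiv.norm_map]
  exact norm_fderiv_le_of_lipschitz ℝ hv

theorem hasDerivAt_comp_ray {g : Bundle N → ℝ} {x : Bundle N} {s : ℝ}
    (hg : DifferentiableAt ℝ g ((1 + s) • x)) :
    HasDerivAt (fun r : ℝ => g ((1 + r) • x)) ⟪x, gradient g ((1 + s) • x)⟫ s := by
  have h1 : HasDerivAt (fun r : ℝ => (1 + r) • x) ((1 : ℝ) • x) s :=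
    ((hasDerivAt_id s).const_add 1).smul_const x
  have h2 := hg.hasGradientAt.hasFDerivAt.comp_hasDerivAt s h1
  rw [one_smul, InnerProductSpace.toDual_apply_apply, real_inner_comm] at h2
  exact h2

theorem hasDerivAt_pow_mul_comp_ray {f : Bundle N → ℝ} {x : Bundle N} {s : ℝ}
    (hf : DifferentiableAt ℝ f ((1 + s) • x)) :
    HasDerivAt (fun r : ℝ => (1 + r) ^ (N + 1) * f ((1 + r) • x))
      ((1 + s) ^ N * phi f ((1 + s) • x)) s := by
  have h1 : HasDerivAt (fun r : ℝ => (1 + r) ^ (N + 1)) (((N + 1 : ℕ) : ℝ) * (1 + s) ^ N) s := by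
    simpa using ((hasDerivAt_id s).const_add 1).fun_pow (N + 1)
  refine (h1.fun_mul (hasDerivAt_comp_ray hf)).congr_deriv ?_
  rw [phi, real_inner_smul_left]
  push_cast
  ring

theorem convex_ray_mem {U : Set (Bundle N)} (hU : Convex ℝ U) {x : Bundle N} (hx : x ∈ U)
    {s r : ℝ} (hs : (1 + s) • x ∈ U) (hr : r ∈ Icc 0 s) : (1 + r) • x ∈ U := by
  have hc : Convex ℝ ((fun r : ℝ => (1 + r) • x) ⁻¹' U) := by
    intro a ha b hb c d hc hd hcd
    have := hU ha hb hc hd hcd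
    simp only [mem_preimage] at this ⊢
    convert this using 1
    rw [smul_smul, smul_smul, ← add_smul]
    congr 1
    simp only [smul_eq_mul]
    linear_combination (-1 : ℝ) * hcd
  have := hc.ordConnected.out (x := 0) (y := s) (by simpa using hx) hs hr
  exact this

/-- The weight `(1 + s) ^ (N + 1)` makes the radial derivative a multiple of `phi f` alone, so no
bound on `∇f` is needed. -/
theorem abs_pow_mul_comp_ray_sub_le {U : Set (Bundle N)} (hU : Convex ℝ U) {f : Bundle N → ℝ}
    (hf : ∀ x ∈ U, DifferentiableAt ℝ f x) {C : ℝ} (hC : ∀ x ∈ U, |phi f x| ≤ C)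
    {x : Bundle N} (hx : x ∈ U) {s : ℝ} (hs : 0 ≤ s) (hs1 : s ≤ 1) (hsx : (1 + s) • x ∈ U) :
    |(1 + s) ^ (N + 1) * f ((1 + s) • x) - f x| ≤ 2 ^ N * C * s := by
  have hC0 : 0 ≤ C := (abs_nonneg _).trans (hC x hx)
  have := (convex_Icc 0 s).norm_image_sub_le_of_norm_hasDerivWithin_le (C := 2 ^ N * C)
    (f := fun r : ℝ => (1 + r) ^ (N + 1) * f ((1 + r) • x))
    (f' := fun r => (1 + r) ^ N * phi f ((1 + r) • x))
    (fun r hr => (hasDerivAt_pow_mul_comp_ray (hf _ (convex_ray_mem hU hx hsx hr))).hasDerivWithinAt)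
    (fun r hr => ?_) (left_mem_Icc.mpr hs) (right_mem_Icc.mpr hs)
  · simpa [abs_of_nonneg hs] using this
  · have h0 : 0 ≤ 1 + r := by linarith [hr.1]
    rw [norm_mul, norm_pow, Real.norm_of_nonneg h0]
    have h2 : 1 + r ≤ 2 := by linarith [hr.2]
    exact mul_le_mul (pow_le_pow_left₀ h0 h2 N) (hC _ (convex_ray_mem hU hx hsx hr))
      (norm_nonneg _) (by positivity)

/-- Integration by parts in the radial direction, for a function that is nonnegative and vanishes
to first order where rays from the origin leave the domain. -/
theorem integral_radial_le_zero {U : Set (Bundle N)} (hU : Convex ℝ U) (hUo : IsOpen U)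
    {R : ℝ} (hR : ∀ x ∈ U, ‖x‖ ≤ R) {f w : Bundle N → ℝ}
    (hfd : ∀ x ∈ U, DifferentiableAt ℝ f x) (hf0 : ∀ x ∈ U, 0 ≤ f x)
    (hfint : IntegrableOn f U) {C : ℝ} (hC : ∀ x ∈ U, |phi f x| ≤ C)
    {L : NNReal} (hw : LipschitzWith L w) (hw0 : ∀ x ∈ U, 0 ≤ w x) {B : ℝ}
    (hwB : ∀ x ∈ U, w x ≤ B) {K : ℝ}
    (hK : ∀ x ∈ U, ∀ s : ℝ, 0 < s → (1 + s) • x ∉ U → w x ≤ K * s) :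
    ∫ x in U, (w x * phi f x + (⟪x, gradient w x⟫ - w x) * f x) ≤ 0 := by
  rcases U.eq_empty_or_nonempty with rfl | ⟨x₀, hx₀⟩
  · simp
  have hR0 : 0 ≤ R := (norm_nonneg _).trans (hR x₀ hx₀)
  have hB0 : 0 ≤ B := (hw0 x₀ hx₀).trans (hwB x₀ hx₀)
  have hC0 : 0 ≤ C := (abs_nonneg _).trans (hC x₀ hx₀)
  have hUm : MeasurableSet U := hUo.measurableSet
  have hvol : volume U ≠ ⊤ :=
    ((Metric.isBounded_closedBall (x := (0 : Bundle N)) (r := R)).subset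
      (fun x hx => by simpa using hR x hx)).measure_lt_top.ne
  set h : Bundle N → ℝ := U.indicator (fun x => w x * f x) with hh
  have hhU : ∀ x ∈ U, h x = w x * f x := fun x hx => indicator_of_mem hx _
  have hhU' : ∀ x, x ∉ U → h x = 0 := fun x hx => indicator_of_notMem hx _
  have hh0 : ∀ x, 0 ≤ h x := indicator_nonneg fun x hx => mul_nonneg (hw0 x hx) (hf0 x hx)
  have hhint : Integrable h := by
    rw [hh, integrable_indicator_iff hUm]
    refine hfint.bdd_mul (c := B) hw.continuous.aestronglyMeasurable ?_
    filter_upwards [ae_restrict_mem hUm] with x hx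
    rw [Real.norm_of_nonneg (hw0 x hx)]
    exact hwB x hx
  have hray : ∀ s : ℝ, Continuous fun x : Bundle N => (1 + s) • x := fun s => by fun_prop
  set V : ℝ → Set (Bundle N) := fun s => {x | (1 + s) • x ∈ U} with hV
  have hVm : ∀ s, MeasurableSet (V s) := fun s => (hUo.preimage (hray s)).measurableSet
  classical
  -- `G s` is the difference quotient of the dilation `h ↦ (1 + s) ^ N h((1 + s) x)`; where the ray
  -- has left `U`, the lower bound `-K f` given by `hK` replaces it.
  set G : ℝ → Bundle N → ℝ := fun s => (V s).piecewise
    (fun x => s⁻¹ * ((1 + s) ^ N * h ((1 + s) • x) - h x)) (fun x => -(K * f x)) with hG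
  have hdiffint : ∀ s : ℝ, 0 < s →
      Integrable (fun x => (1 + s) ^ N * h ((1 + s) • x) - h x) := fun s hs =>
    ((hhint.comp_smul (by positivity : (1 + s) ≠ 0)).const_mul _).sub hhint
  have hGint : ∀ s : ℝ, 0 < s → IntegrableOn (G s) U := fun s hs =>
    Integrable.piecewise (hVm s) ((hdiffint s hs).const_mul s⁻¹).integrableOn.integrableOn
      (hfint.const_mul K).neg.integrableOn
  -- Each approximating integral is nonpositive, by the scaling invariance of Lebesgue measure.
  have hGle : ∀ s : ℝ, 0 < s → ∫ x in U, G s x ≤ 0 := by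
    intro s hs
    have hzero : ∫ x, s⁻¹ * ((1 + s) ^ N * h ((1 + s) • x) - h x) = 0 := by
      have hpos : 0 < (1 + s) ^ N := by positivity
      rw [integral_const_mul, integral_sub
        ((hhint.comp_smul (by positivity : (1 + s) ≠ 0)).const_mul _) hhint,
        integral_const_mul, Measure.integral_comp_smul, finrank_euclideanSpace_fin,
        abs_of_pos (inv_pos.mpr hpos), smul_eq_mul, mul_inv_cancel_left₀ hpos.ne', sub_self,
        mul_zero]
    rw [← hzero, ← integral_indicator hUm]
    refine integral_mono ((integrable_indicator_iff hUm).mpr (hGint s hs))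
      ((hdiffint s hs).const_mul s⁻¹) fun x => ?_
    by_cases hx : x ∈ U
    · simp only [indicator_of_mem hx]
      by_cases hxV : x ∈ V s
      · rw [hG]; simp only [piecewise_eq_of_mem _ _ _ hxV]; exact le_rfl
      · rw [hG]; simp only [piecewise_eq_of_notMem _ _ _ hxV]
        rw [hhU' _ hxV, hhU x hx]
        have h1 := mul_le_mul_of_nonneg_right (hK x hx s hs hxV) (hf0 x hx)
        have h2 : s⁻¹ * (w x * f x) ≤ s⁻¹ * (K * s * f x) :=
          mul_le_mul_of_nonneg_left h1 (by positivity)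
        have h3 : s⁻¹ * (K * s * f x) = K * f x := by field_simp
        linarith
    -- Rays entering `U` from outside contribute a nonnegative quotient, so dropping them keeps the
    -- inequality.
    · simp only [indicator_of_notMem hx]
      rw [hhU' x hx]
      have := hh0 ((1 + s) • x)
      simp only [sub_zero]
      positivity
  have hlim : Filter.Tendsto (fun s => ∫ x in U, G s x) (𝓝[>] 0)
      (𝓝 (∫ x in U, (w x * phi f x + (⟪x, gradient w x⟫ - w x) * f x))) := by
    refine tendsto_integral_filter_of_dominated_convergence
      (fun x => B * (2 ^ N * C) + (L * R + B + |K|) * f x) ?_ ?_ ?_ ?_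
    · filter_upwards [self_mem_nhdsWithin] with s hs using (hGint s hs).aestronglyMeasurable
    · filter_upwards [Ioo_mem_nhdsGT (zero_lt_one' ℝ)] with s hs
      filter_upwards [ae_restrict_mem hUm] with x hx
      have hs0 : 0 < s := hs.1
      have hfx := hf0 x hx
      by_cases hxV : x ∈ V s
      · rw [hG]; simp only [piecewise_eq_of_mem _ _ _ hxV]
        have hxV' : (1 + s) • x ∈ U := hxV
        rw [hhU _ hxV', hhU x hx]
        -- Regrouping so that `f` varies only through `(1 + s) ^ (N + 1) f`; the surplus factor `1 +
        -- s` yields the term `s * w x`.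
        have e : s⁻¹ * ((1 + s) ^ N * (w ((1 + s) • x) * f ((1 + s) • x)) - w x * f x)
            = s⁻¹ * ((1 + s)⁻¹ * (w ((1 + s) • x) *
                ((1 + s) ^ (N + 1) * f ((1 + s) • x) - f x) +
                ((w ((1 + s) • x) - w x) - s * w x) * f x)) := by
          have : 1 + s ≠ 0 := by positivity
          field_simp
          ring
        have b1 := abs_pow_mul_comp_ray_sub_le hU hfd hC hx hs0.le hs.2.le hxV'
        have b2 : |w ((1 + s) • x) - w x| ≤ L * R * s := by
          have := hw.dist_le_mul ((1 + s) • x) x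
          rw [Real.dist_eq, dist_eq_norm, add_smul, one_smul, add_sub_cancel_left, norm_smul,
            Real.norm_of_nonneg hs0.le] at this
          have h5 : (L : ℝ) * (s * ‖x‖) ≤ L * (s * R) := by
            have := hR x hx
            gcongr
          rw [add_smul, one_smul]
          linarith
        have b3 : |w ((1 + s) • x)| ≤ B := by
          rw [abs_of_nonneg (hw0 _ hxV')]; exact hwB _ hxV'
        have b4 : |w x| ≤ B := by rw [abs_of_nonneg (hw0 _ hx)]; exact hwB _ hx
        have b5 : |(w ((1 + s) • x) - w x) - s * w x| ≤ L * R * s + s * B := by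
          refine (abs_sub _ _).trans (add_le_add b2 ?_)
          rw [abs_mul, abs_of_pos hs0]
          gcongr
        have b6 : |w ((1 + s) • x) * ((1 + s) ^ (N + 1) * f ((1 + s) • x) - f x) +
                ((w ((1 + s) • x) - w x) - s * w x) * f x| ≤
              s * (B * (2 ^ N * C) + (L * R + B) * f x) := by
          refine (abs_add_le _ _).trans ?_
          rw [abs_mul, abs_mul, abs_of_nonneg hfx]
          have := mul_le_mul b3 b1 (abs_nonneg _) hB0
          have := mul_le_mul_of_nonneg_right b5 hfx
          linarith
        have b7 : (1 + s)⁻¹ ≤ 1 := inv_le_one_of_one_le₀ (by linarith)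
        rw [e, norm_mul, norm_mul, Real.norm_of_nonneg (inv_nonneg.mpr hs0.le),
          Real.norm_of_nonneg (by positivity : 0 ≤ (1 + s)⁻¹), Real.norm_eq_abs]
        calc s⁻¹ * ((1 + s)⁻¹ * _)
            ≤ s⁻¹ * (1 * (s * (B * (2 ^ N * C) + (L * R + B) * f x))) := by gcongr
          _ = B * (2 ^ N * C) + (L * R + B) * f x := by field_simp
          _ ≤ _ := by nlinarith [mul_nonneg (abs_nonneg K) hfx]
      · rw [hG]; simp only [piecewise_eq_of_notMem _ _ _ hxV]
        rw [norm_neg, norm_mul, Real.norm_eq_abs, Real.norm_of_nonneg hfx]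
        have : 0 ≤ B * (2 ^ N * C) + (L * R + B) * f x := by positivity
        linarith
    · exact (integrableOn_const hvol).add (hfint.const_mul _)
    · filter_upwards [ae_restrict_mem hUm, ae_restrict_of_ae hw.ae_differentiableAt] with x hx hwx
      have hev : ∀ᶠ s in 𝓝[>] (0 : ℝ), (1 + s) • x ∈ U :=
        nhdsWithin_le_nhds ((by fun_prop : Continuous fun s : ℝ => (1 + s) • x).continuousAt
          |>.preimage_mem_nhds (hUo.mem_nhds (by simpa using hx)))
      have hd : HasDerivAt (fun r : ℝ => (1 + r) ^ N * (w ((1 + r) • x) * f ((1 + r) • x)))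
          (w x * phi f x + (⟪x, gradient w x⟫ - w x) * f x) 0 := by
        have h1 : HasDerivAt (fun r : ℝ => (1 + r) ^ N) (N : ℝ) 0 := by
          simpa using ((hasDerivAt_id (0 : ℝ)).const_add 1).fun_pow N
        have h2 := hasDerivAt_comp_ray (g := w) (x := x) (s := 0) (by simpa using hwx)
        have h3 := hasDerivAt_comp_ray (g := f) (x := x) (s := 0) (by simpa using hfd x hx)
        refine (h1.fun_mul (h2.fun_mul h3)).congr_deriv ?_
        simp only [phi, add_zero, one_smul, one_pow, one_mul]
        ring
      have ht := (hasDerivAt_iff_tendsto_slope.mp hd).mono_left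
        (nhdsWithin_mono 0 (fun s (hs : 0 < s) => hs.ne'))
      refine ht.congr' ?_
      filter_upwards [hev] with s hs
      rw [hG]; simp only [piecewise_eq_of_mem _ _ _ (show x ∈ V s from hs)]
      rw [slope_def_field, hhU _ hs, hhU x hx]
      simp [div_eq_inv_mul]
  exact le_of_tendsto hlim (by filter_upwards [self_mem_nhdsWithin] with s hs using hGle s hs)

/-! ### Comparison with the mechanism restricted to `S`. -/

theorem integrableOn_revenue {U : Set (Bundle N)} (hU : MeasurableSet U)
    (hUb : Bornology.IsBounded U) {f v : Bundle N → ℝ} (hf : IntegrableOn f U) {L : NNReal}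
    (hv : LipschitzWith L v) : IntegrableOn (fun x => (⟪x, gradient v x⟫ - v x) * f x) U := by
  obtain ⟨R, hR⟩ := hUb.exists_norm_le
  refine hf.bdd_mul (c := R * L + (|v 0| + L * R)) ?_ ?_
  · exact ((measurable_id.inner (measurable_gradient v)).sub
      hv.continuous.measurable).aestronglyMeasurable
  · filter_upwards [ae_restrict_mem hU] with x hx
    have hxR := hR x hx
    have hL := L.coe_nonneg
    have h1 : |⟪x, gradient v x⟫| ≤ R * L :=
      (abs_real_inner_le_norm _ _).trans (mul_le_mul hxR (norm_gradient_le_of_lipschitzWith hv x)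
        (norm_nonneg _) ((norm_nonneg _).trans hxR))
    have h2 : |v x - v 0| ≤ L * R := by
      have := hv.dist_le_mul x 0
      rw [Real.dist_eq, dist_zero_right] at this
      exact this.trans (by gcongr)
    have h3 : |v x| ≤ |v 0| + L * R := by
      have := abs_sub_abs_le_abs_sub (v x) (v 0)
      linarith
    exact (abs_sub _ _).trans (add_le_add h1 h3)

/-- Up to a constant, the biconjugate with slopes in `S` is the indirect utility, on `X`, of a
feasible price schedule. -/
theorem exists_feasible_indirectUtility_eq {X Q S : Set (Bundle N)}
    (hX : Bornology.IsBounded X) (hQ : Bornology.IsBounded Q) (hSQ : S ⊆ Q) (h0 : 0 ∈ S)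
    {c : Bundle N → ℝ} (hc : BddBelow (c '' S)) :
    ∃ p' : Bundle N → ℝ, Feasible Q p' ∧
      ∀ x ∈ X, indirectUtility Q p' x = indirectUtility S c x + c 0 := by
  classical
  obtain ⟨R, hR⟩ := hX.exists_norm_le
  obtain ⟨T, hT⟩ := hQ.exists_norm_le
  have hS := hQ.subset hSQ
  -- The price `R * T ≥ ⟪x, a⟫` makes every bundle outside `S` no better than the free zero bundle.
  set p' : Bundle N → ℝ := S.piecewise (fun a => c a - c 0) (fun _ => R * T) with hp'
  have hpS : ∀ a ∈ S, p' a = c a - c 0 := fun a ha => piecewise_eq_of_mem _ _ _ ha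
  have hpS' : ∀ a, a ∉ S → p' a = R * T := fun a ha => piecewise_eq_of_notMem _ _ _ ha
  have hbdd : BddBelow (p' '' Q) := by
    obtain ⟨b, hb⟩ := hc
    refine ⟨min (b - c 0) (R * T), ?_⟩
    rintro _ ⟨a, -, rfl⟩
    by_cases ha : a ∈ S
    · rw [hpS a ha]
      exact (min_le_left _ _).trans (sub_le_sub_right (hb ⟨a, ha, rfl⟩) _)
    · rw [hpS' a ha]
      exact min_le_right _ _
  refine ⟨p', ⟨by rw [hpS 0 h0, sub_self], hbdd⟩, fun x hx => le_antisymm ?_ ?_⟩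
  · refine indirectUtility_le ⟨0, hSQ h0⟩ fun a ha => ?_
    by_cases haS : a ∈ S
    · rw [hpS a haS]
      have := inner_sub_le_indirectUtility hS hc haS x
      linarith
    · rw [hpS' a haS]
      have h1 := real_inner_le_norm x a
      have h2 := mul_le_mul (hR x hx) (hT a ha) (norm_nonneg _) ((norm_nonneg _).trans (hR x hx))
      have h3 := inner_sub_le_indirectUtility hS hc h0 x
      rw [inner_zero_right] at h3
      linarith
  · rw [← le_sub_iff_add_le]
    refine indirectUtility_le ⟨0, h0⟩ fun a ha => ?_
    have := inner_sub_le_indirectUtility hQ hbdd (hSQ ha) x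
    rw [hpS a ha] at this
    linarith

theorem continuousOn_phi {U : Set (Bundle N)} (hU : IsOpen U) {f : Bundle N → ℝ}
    (hf : ContDiffOn ℝ 1 f U) : ContinuousOn (phi f) U := by
  have h1 : ContinuousOn (gradient f) U :=
    (InnerProductSpace.toDual ℝ (Bundle N)).symm.continuous.comp_continuousOn
      (hf.continuousOn_fderiv_of_isOpen hU le_rfl)
  exact (continuousOn_id.inner h1).add (continuousOn_const.mul hf.continuousOn)

/-- Continuity of `phi f` upgrades the essential bound to a pointwise one, as needed along
individual rays. -/
theorem abs_phi_le_of_ae {U : Set (Bundle N)} (hU : IsOpen U) {f : Bundle N → ℝ}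
    (hf : ContDiffOn ℝ 1 f U) {C : ℝ} (hC : ∀ᵐ x ∂(volume.restrict U), |phi f x| ≤ C) :
    ∀ x ∈ U, |phi f x| ≤ C := by
  have h1 : (fun x => max |phi f x| C) =ᵐ[volume.restrict U] fun _ => C := by
    filter_upwards [hC] with x hx using max_eq_right hx
  intro x hx
  have := Measure.eqOn_open_of_ae_eq h1 hU
    ((continuousOn_phi hU hf).abs.sup continuousOn_const) continuousOn_const hx
  exact max_eq_right_iff.mp this

/-- At an optimal mechanism, the indirect utility is the supremum of its supporting affine functions
with slopes in `S`, for every compact `S` between `Q_A ∪ {0}` and `Q`. -/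
theorem indirectUtility_eqOn_biconjugate_of_isOptimal {X Q : Set (Bundle N)}
    (hXconv : Convex ℝ X) (hXcomp : IsCompact X) (hXint : (interior X).Nonempty)
    (hQcomp : IsCompact Q) {f : Bundle N → ℝ}
    (hfnonneg : ∀ x ∈ X, 0 ≤ f x) (hfint : IntegrableOn f X volume)
    (hfC1 : ContDiffOn ℝ 1 f (interior X))
    (hphi : ∃ C : ℝ, ∀ᵐ x ∂(volume.restrict X), |phi f x| ≤ C)
    (hreg : StrictlyRegular X f) {p : Bundle N → ℝ} (hp : IsOptimal X Q f p)
    {S : Set (Bundle N)} (hSQ : S ⊆ Q) (h0 : 0 ∈ S) (hAS : candidateBundles X Q ⊆ S) :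
    EqOn (indirectUtility Q p) (indirectUtility S (indirectUtility X (indirectUtility Q p)))
      (interior X) := by
  set u := indirectUtility Q p
  set c := indirectUtility X u
  set v := indirectUtility S c
  set U := interior X
  have hUX : U ⊆ X := interior_subset
  have hUo : IsOpen U := isOpen_interior
  have hXne : X.Nonempty := hXint.mono hUX
  have hQb := hQcomp.isBounded
  have hXb := hXcomp.isBounded
  have hSb := hQb.subset hSQ
  have hQne : Q.Nonempty := ⟨0, hSQ h0⟩
  have hu0 : ∀ x, 0 ≤ u x := fun x => by
    have := inner_sub_le_indirectUtility hQb hp.1.2 (hSQ h0) x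
    rwa [hp.1.1, inner_zero_right, sub_zero] at this
  have hubdd : BddBelow (u '' X) := ⟨0, by rintro _ ⟨x, -, rfl⟩; exact hu0 x⟩
  have hcbdd : BddBelow (c '' S) := bddBelow_indirectUtility_image hXne hXb hubdd hSb
  -- Normalizing the zero price shifts `v` by `c 0 ≤ 0`, which changes revenue by `-c 0 * ∫ f ≥ 0`.
  have hc0 : c 0 ≤ 0 := indirectUtility_le hXne fun y _ => by
    rw [inner_zero_left]
    linarith [hu0 y]
  obtain ⟨Lu, hLu⟩ := exists_lipschitzWith_indirectUtility hQne hQb hp.1.2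
  obtain ⟨Lv, hLv⟩ := exists_lipschitzWith_indirectUtility ⟨0, h0⟩ hSb hcbdd
  have hvu : ∀ x ∈ X, v x ≤ u x := fun x hx =>
    indirectUtility_indirectUtility_le hXb hubdd ⟨0, h0⟩ hx
  obtain ⟨p', hp'feas, hp'eq⟩ := exists_feasible_indirectUtility_eq hXb hQb hSQ h0 hcbdd
  obtain ⟨L', hL'⟩ := exists_lipschitzWith_indirectUtility hQne hQb hp'feas.2
  have hrestr : (volume : Measure (Bundle N)).restrict X = volume.restrict U :=
    (Measure.restrict_congr_set (interior_ae_eq_of_null_frontier (hXconv.addHaar_frontier _))).symm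
  have hfintU : IntegrableOn f U := hfint.mono_set hUX
  obtain ⟨C, hC⟩ := hphi
  rw [hrestr] at hC
  have hreg' : ∀ᵐ x ∂(volume.restrict U), 0 < phi f x := by rw [← hrestr]; exact hreg
  have hLw : LipschitzWith (Lu + Lv) fun x => u x - v x := hLu.sub hLv
  obtain ⟨B, hB⟩ := (hXcomp.image hLw.continuous).bddAbove
  obtain ⟨R, hR⟩ := hXb.exists_norm_le
  -- `u - v ≤ 0` at the exit point, at distance at most `s * R`; the Lipschitz bound does the rest.
  have hexit : ∀ x ∈ U, ∀ s : ℝ, 0 < s → (1 + s) • x ∉ U →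
      u x - v x ≤ ((Lu + Lv : NNReal) : ℝ) * R * s := by
    intro x hx s hs hsx
    obtain ⟨r, hr, ht⟩ := exists_topBoundary_on_ray hXcomp hx hs.le hsx
    obtain ⟨a, ha, hsub⟩ := exists_subgradient_indirectUtility hQne hQcomp hp.1.2 ((1 + r) • x)
    have h1 : u ((1 + r) • x) ≤ v ((1 + r) • x) :=
      le_biconjugate_of_mem_topBoundary hXconv hXint hXcomp hQcomp hubdd hSb hAS ht ha hsub
    have h2 := (le_abs_self _).trans (hLw.dist_le_mul x ((1 + r) • x))
    rw [dist_eq_norm, add_smul, one_smul, sub_add_cancel_left, norm_neg, norm_smul,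
      Real.norm_of_nonneg hr.1] at h2
    rw [add_smul, one_smul] at h1
    have h3 : r * ‖x‖ ≤ s * R := mul_le_mul hr.2 (hR x (hUX hx)) (norm_nonneg _) hs.le
    have h4 := mul_le_mul_of_nonneg_left h3 (Lu + Lv).coe_nonneg
    linarith
  have hibp := integral_radial_le_zero hXconv.interior hUo (fun x hx => hR x (hUX hx))
    (fun x hx => (hfC1.differentiableOn one_ne_zero).differentiableAt (hUo.mem_nhds hx))
    (fun x hx => hfnonneg x (hUX hx)) hfintU (abs_phi_le_of_ae hUo hfC1 hC) hLw
    (fun x hx => sub_nonneg.mpr (hvu x (hUX hx))) (fun x hx => hB ⟨x, hUX hx, rfl⟩) hexit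
  have hwphi : IntegrableOn (fun x => (u x - v x) * phi f x) U := by
    refine ((hLw.continuous.continuousOn.integrableOn_compact hXcomp).mono_set hUX).mul_bdd
      (c := C) ?_ hC
    exact (continuousOn_phi hUo hfC1).aestronglyMeasurable hUo.measurableSet
  have hUb := hXb.subset hUX
  have hIu := integrableOn_revenue hUo.measurableSet hUb hfintU hLu
  have hI' := integrableOn_revenue hUo.measurableSet hUb hfintU hL'
  have hae : (fun x => (u x - v x) * phi f x +
      (⟪x, gradient (fun x => u x - v x) x⟫ - (u x - v x)) * f x) =ᵐ[volume.restrict U]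
      fun x => (u x - v x) * phi f x + ((⟪x, gradient u x⟫ - u x) * f x -
        (⟪x, gradient (indirectUtility Q p') x⟫ - indirectUtility Q p' x) * f x - c 0 * f x) := by
    filter_upwards [ae_restrict_mem hUo.measurableSet, ae_restrict_of_ae hLu.ae_differentiableAt,
      ae_restrict_of_ae hLv.ae_differentiableAt] with x hx hdu hdv
    have h1 : gradient (fun x => u x - v x) x = gradient u x - gradient v x := by
      simp only [gradient]
      rw [fderiv_fun_sub hdu hdv, map_sub]
    have h2 : gradient (indirectUtility Q p') x = gradient v x := by
      have : indirectUtility Q p' =ᶠ[𝓝 x] fun y => v y + c 0 := by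
        filter_upwards [hUo.mem_nhds hx] with y hy using hp'eq y (hUX hy)
      simp only [gradient]
      rw [this.fderiv_eq, fderiv_add_const]
    rw [h1, h2, hp'eq x (hUX hx), inner_sub_right]
    ring
  have hIsub : IntegrableOn (fun x => (⟪x, gradient u x⟫ - u x) * f x -
      (⟪x, gradient (indirectUtility Q p') x⟫ - indirectUtility Q p' x) * f x) U := hIu.sub hI'
  have hIc : IntegrableOn (fun x => c 0 * f x) U := hfintU.const_mul _
  have hIall : IntegrableOn (fun x => (⟪x, gradient u x⟫ - u x) * f x -
      (⟪x, gradient (indirectUtility Q p') x⟫ - indirectUtility Q p' x) * f x - c 0 * f x) U :=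
    hIsub.sub hIc
  rw [integral_congr_ae hae, integral_add hwphi hIall, integral_sub hIsub hIc,
    integral_sub hIu hI', integral_const_mul] at hibp
  have hopt := hp.2 p' hp'feas
  rw [totalRevenue, totalRevenue, hrestr] at hopt
  have hf0 : 0 ≤ ∫ x in U, f x :=
    setIntegral_nonneg hUo.measurableSet fun x hx => hfnonneg x (hUX hx)
  have hle : ∫ x in U, (u x - v x) * phi f x ≤ 0 := by
    linarith [mul_nonpos_of_nonpos_of_nonneg hc0 hf0]
  have hnn : 0 ≤ᵐ[volume.restrict U] fun x => (u x - v x) * phi f x := by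
    filter_upwards [ae_restrict_mem hUo.measurableSet, hreg'] with x hx hx'
    exact mul_nonneg (sub_nonneg.mpr (hvu x (hUX hx))) hx'.le
  have hzero := (setIntegral_eq_zero_iff_of_nonneg_ae hnn hwphi).mp
    (le_antisymm hle (integral_nonneg_of_ae hnn))
  refine Measure.eqOn_open_of_ae_eq (μ := volume) ?_ hUo hLu.continuous.continuousOn
    hLv.continuous.continuousOn
  filter_upwards [hzero, hreg'] with x hx hx'
  exact sub_eq_zero.mp ((mul_eq_zero.mp hx).resolve_right hx'.ne')

end Screening

/-! ### Conclusion: active bundles. -/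

open Screening

theorem theorem2 {N : ℕ} (hN : 0 < N) (X Q : Set (Bundle N))
    (hXconv : Convex ℝ X) (hXcomp : IsCompact X) (hXint : (interior X).Nonempty)
    (hXpos : ∀ x ∈ X, ∀ i, 0 ≤ x i)
    (hQconv : Convex ℝ Q) (hQcomp : IsCompact Q) (hQint : (interior Q).Nonempty)
    (hQpos : ∀ q ∈ Q, ∀ i, 0 ≤ q i) (hQzero : (0 : Bundle N) ∈ Q)
    (f : Bundle N → ℝ)
    (hfnonneg : ∀ x ∈ X, 0 ≤ f x) (hfint : IntegrableOn f X volume) (hfone : ∫ x in X, f x = 1)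
    (hfC1 : ContDiffOn ℝ 1 f (interior X))
    (hphi : ∃ C : ℝ, ∀ᵐ x ∂(volume.restrict X), |Screening.phi f x| ≤ C)
    (hreg : Screening.StrictlyRegular X f)
    (p : Bundle N → ℝ) (hp : Screening.IsOptimal X Q f p)
    (q : Bundle N) (hq : Screening.IsActive X Q f p q) :
    q ∈ closure (Screening.candidateBundles X Q) := by
  by_contra hqA
  have hAQ : candidateBundles X Q ⊆ Q := fun a ha => hQcomp.isClosed.frontier_subset ha.1
  -- Feasibility of the comparison schedule needs the zero bundle; adding it is harmless since
  -- active bundles are nonzero.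
  set S : Set (Bundle N) := insert 0 (closure (candidateBundles X Q))
  have hSQ : S ⊆ Q := insert_subset hQzero (closure_minimal hAQ hQcomp.isClosed)
  have hScomp : IsCompact S :=
    (hQcomp.of_isClosed_subset isClosed_closure (closure_minimal hAQ hQcomp.isClosed)).insert 0
  have h0 : (0 : Bundle N) ∈ S := mem_insert _ _
  have heq := indirectUtility_eqOn_biconjugate_of_isOptimal hXconv hXcomp hXint hQcomp hfnonneg
    hfint hfC1 hphi hreg hp hSQ h0 (subset_closure.trans (subset_insert _ _))
  set u := indirectUtility Q p
  have hqS : q ∉ S := by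
    rintro (h | h)
    exacts [hq.2.1 h, hqA h]
  obtain ⟨δ, hδ, hball⟩ := Metric.isOpen_iff.mp hScomp.isClosed.isOpen_compl q hqS
  have hXne : X.Nonempty := hXint.mono interior_subset
  have hubdd : BddBelow (u '' X) :=
    bddBelow_indirectUtility_image ⟨0, hQzero⟩ hQcomp.isBounded hp.1.2 hXcomp.isBounded
  obtain ⟨L, hL⟩ := exists_lipschitzWith_indirectUtility ⟨0, hQzero⟩ hQcomp.isBounded hp.1.2
  refine (hq.2.2 δ hδ).ne' (withDensity_absolutelyContinuous _ _ ?_)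
  rw [← Measure.restrict_congr_set
    (interior_ae_eq_of_null_frontier (hXconv.addHaar_frontier volume))]
  -- At an interior type where `u` is differentiable, the demanded bundle and a slope from `S` both
  -- equal the gradient, contradicting that the ball misses `S`.
  refine measure_mono_null (t := {x | ¬ (x ∈ interior X ∧ DifferentiableAt ℝ u x)}) ?_
    (ae_iff.mp ((ae_restrict_mem measurableSet_interior).and
      (ae_restrict_of_ae hL.ae_differentiableAt)))
  rintro x hx ⟨hxU, hdiff⟩
  obtain ⟨a, ⟨haδ, haQ⟩, hxa⟩ := mem_iUnion₂.mp hx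
  have hga : gradient u x = a := gradient_eq_of_eventually_le hdiff (Filter.Eventually.of_forall
    (subgradient_of_mem_demandSet ⟨0, hQzero⟩ hQcomp.isBounded hp.1.2 haQ hxa))
  obtain ⟨b, hbS, hb⟩ := exists_subgradient_indirectUtility ⟨0, h0⟩ hScomp
    (bddBelow_indirectUtility_image hXne hXcomp.isBounded hubdd hScomp.isBounded) x
  have hgb : gradient u x = b := by
    refine gradient_eq_of_eventually_le hdiff ?_
    filter_upwards [isOpen_interior.mem_nhds hxU] with y hy
    rw [heq hxU, heq hy]
    exact hb y
  exact hball haδ (hga.symm.trans hgb ▸ hbS)
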